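/- Let $A$ be a (real) Banach lattice algebra with identity $e$, that is, a real Banach lattice with an associative bilinear product such that $\|xy\|\le\|x\|\,\|y\|$ for all $x,y\in A$, such that $xy\ge 0$ whenever $x,y\ge 0$, and such that there is a two-sided identity $e$ with $\|e\|=1$. Let $A_e$ be the order ideal generated by $e$, that is, the smallest solid linear subspace (sublattice) of $A$ containing $e$, and for $x\in A_e$ let $\|x\|_e=\inf\{\lambda>0 : |x|\le\lambda e\}$. (i) $A_e$ is a subalgebra of $A$, and $(A_e,\|\cdot\|_e)$, with the order and product of $A$, is a Banach lattice algebra with identity $e$. Moreover, there are a compact Hausdorff space $K$ and a bijection $T\colon A_e\to C(K)$ onto the space of real-valued continuous functions on $K$ (with pointwise order and product and the supremum norm) that is an algebra isomorphism, a lattice isomorphism, and an isometry for $\|\cdot\|_e$. (ii) $A_e$ is a principal projection band in $A$: it is an order closed ideal (if an increasing net in $A_e$ has a supremum in $A$, this supremum lies in $A_e$), it coincides with the band generated by $e$, and $A=A_e\oplus A_e^{d}$, where $A_e^{d}=\{x\in A : |x|\wedge|y|=0 \text{ for all } y\in A_e\}$. (iii) $A_e$ is an inverse closed subalgebra of $A$: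 if $a\in A_e$ is invertible in $A$, then $a^{-1}\in A_e$. -/

import Mathlib

namespace BLA

section VectorLattice

variable {X : Type*} [AddCommGroup X] [Module ℝ X] [Lattice X]

/-- A linear subspace that is closed under the modulus and solid. -/
structure IsOrderIdeal (I : Submodule ℝ X) : Prop where
  abs_mem : ∀ y ∈ I, |y| ∈ I
  solid : ∀ x y : X, |x| ≤ |y| → y ∈ I → x ∈ I

/-- The smallest order ideal containing `e`. -/
def idealGen (e : X) : Submodule ℝ X :=
  sInf {I : Submodule ℝ X | IsOrderIdeal I ∧ e ∈ I}

/-- The norm associated with `e` on the order ideal generated by `e`. -/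
noncomputable def unitNorm (e x : X) : ℝ :=
  sInf {r : ℝ | 0 < r ∧ |x| ≤ r • e}

/-- An order closed ideal. Increasing nets are replaced by their ranges, the nonempty upwards
directed sets. -/
structure IsBand (B : Submodule ℝ X) : Prop where
  isOrderIdeal : IsOrderIdeal B
  sup_mem : ∀ (S : Set X) (x : X), S ⊆ (B : Set X) → S.Nonempty → DirectedOn (· ≤ ·) S →
    IsLUB S x → x ∈ B

/-- The smallest band containing `e`. -/
def bandGen (e : X) : Submodule ℝ X :=
  sInf {B : Submodule ℝ X | IsBand B ∧ e ∈ B}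

/-- The disjoint complement of `B`. -/
def disjointCompl (B : Submodule ℝ X) : Set X :=
  {x : X | ∀ y ∈ B, |x| ⊓ |y| = 0}

/-- A band `B` such that the whole space is the direct sum of `B` and its disjoint complement. -/
structure IsProjectionBand (B : Submodule ℝ X) : Prop where
  isBand : IsBand B
  decomp : ∀ x : X, ∃! p : X × X, p.1 ∈ B ∧ p.2 ∈ disjointCompl B ∧ x = p.1 + p.2

/-- A projection band that is generated, as a band, by a single element. -/
structure IsPrincipalProjectionBand (B : Submodule ℝ X) : Prop where
  isProjectionBand : IsProjectionBand B
  principal : ∃ u : X, B = bandGen u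

end VectorLattice

section Algebra

variable {A : Type*} [Ring A] [Algebra ℝ A] [Lattice A]

/-- The unital subalgebra `B`, with the order and the operations inherited from `A` and with the
norm `N`, is a Banach lattice algebra with identity (of norm one). -/
structure IsBanachLatticeAlgebra (B : Subalgebra ℝ A) (N : A → ℝ) : Prop where
  sup_mem : ∀ x ∈ B, ∀ y ∈ B, x ⊔ y ∈ B
  inf_mem : ∀ x ∈ B, ∀ y ∈ B, x ⊓ y ∈ B
  norm_nonneg : ∀ x ∈ B, 0 ≤ N x
  norm_eq_zero : ∀ x ∈ B, N x = 0 ↔ x = 0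
  norm_smul : ∀ (r : ℝ), ∀ x ∈ B, N (r • x) = |r| * N x
  norm_add_le : ∀ x ∈ B, ∀ y ∈ B, N (x + y) ≤ N x + N y
  norm_solid : ∀ x ∈ B, ∀ y ∈ B, |x| ≤ |y| → N x ≤ N y
  complete : ∀ u : ℕ → A, (∀ n, u n ∈ B) →
    (∀ ε > 0, ∃ n₀ : ℕ, ∀ m ≥ n₀, ∀ n ≥ n₀, N (u m - u n) < ε) →
    ∃ x ∈ B, Filter.Tendsto (fun n => N (u n - x)) Filter.atTop (nhds 0)
  norm_mul_le : ∀ x ∈ B, ∀ y ∈ B, N (x * y) ≤ N x * N y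
  mul_nonneg : ∀ x ∈ B, ∀ y ∈ B, 0 ≤ x → 0 ≤ y → 0 ≤ x * y
  norm_one : N 1 = 1

/-- The algebra isomorphism `T` from `B` (with the order inherited from `A` and the norm `N`) onto
`C(K, ℝ)` is a lattice isomorphism and an isometry. -/
structure IsLatticeIsometry {K : Type*} [TopologicalSpace K] [CompactSpace K]
    (B : Subalgebra ℝ A) (N : A → ℝ) (T : B ≃ₐ[ℝ] C(K, ℝ)) : Prop where
  map_sup : ∀ x y : B, ∃ h : (x : A) ⊔ (y : A) ∈ B, T ⟨(x : A) ⊔ (y : A), h⟩ = T x ⊔ T y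
  map_inf : ∀ x y : B, ∃ h : (x : A) ⊓ (y : A) ∈ B, T ⟨(x : A) ⊓ (y : A), h⟩ = T x ⊓ T y
  norm_map : ∀ x : B, ‖T x‖ = N x

/-- The inverse of every element of `B` that is invertible in `A` lies in `B`. -/
def IsInverseClosed (B : Subalgebra ℝ A) : Prop :=
  ∀ u : Aˣ, (u : A) ∈ B → ((u⁻¹ : Aˣ) : A) ∈ B

end Algebra

end BLA

universe u

set_option linter.unusedSectionVars false

namespace BLA

/-! ### Moduli and order ideals in vector lattices -/

section VectorLattice

variable {X : Type*} [AddCommGroup X] [Lattice X] [IsOrderedAddMonoid X]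

/-! Everything rests on one estimate, `inf_smul_one_le_norm_smul_one`: `x ⊓ r • 1 ≤ ‖x‖ • 1` for `x
≥ 0` and every real `r`. Disjoint elements below multiples of the identity have product zero. Hence,
if `g` is the positive part of `a - c • 1` with `a = x ⊓ r • 1` and `c > ‖x‖`, then `c • g ≤ a * g`,
and submultiplicativity of the norm forces `g = 0`.

On the ideal this reads `|x| ≤ ‖x‖ • 1`. So the order unit norm is the given norm, and the ideal is
closed, hence complete. For arbitrary `x ≥ 0` the truncations of `x` by multiples of `1` stop
growing at `x ⊓ ‖x‖ • 1`, which is therefore the component of `x` in the ideal; this gives the band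
property and the projection. If `a` in the ideal is invertible and `b + d` decomposes its inverse,
then `a * d = 1 - a * b` lies both in the ideal and in its disjoint complement, so `d = 0`.

For the representation, `K` is the set of lattice characters with the topology of pointwise
convergence. Maximal order ideals supply enough characters to recover the norm, and
Stone–Weierstrass together with completeness gives surjectivity. -/

theorem add_inf_le_inf_add_inf {a b c : X} (ha : 0 ≤ a) (hb : 0 ≤ b) (hc : 0 ≤ c) :
    (a + b) ⊓ c ≤ a ⊓ c + b ⊓ c := by
  rw [inf_add, add_inf, add_inf]
  refine le_inf (le_inf inf_le_left ?_) (le_inf ?_ ?_)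
  · exact inf_le_right.trans (le_add_of_nonneg_left ha)
  · exact inf_le_right.trans (le_add_of_nonneg_right hb)
  · exact inf_le_right.trans (le_add_of_nonneg_left hc)

theorem abs_sup_sub_sup_le (a b c d : X) : |a ⊔ b - c ⊔ d| ≤ |a - c| + |b - d| := by
  have key : ∀ a b c d : X, a ⊔ b - c ⊔ d ≤ |a - c| + |b - d| := by
    intro a b c d
    rw [sub_le_iff_le_add]
    refine sup_le ?_ ?_
    · calc a = (a - c) + 0 + c := by abel
        _ ≤ |a - c| + |b - d| + c ⊔ d :=
          add_le_add (add_le_add (le_abs_self _) (abs_nonneg _)) le_sup_left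
    · calc b = 0 + (b - d) + d := by abel
        _ ≤ |a - c| + |b - d| + c ⊔ d :=
          add_le_add (add_le_add (abs_nonneg _) (le_abs_self _)) le_sup_right
  refine abs_le'.2 ⟨key a b c d, ?_⟩
  rw [neg_sub, abs_sub_comm a, abs_sub_comm b]
  exact key c d a b

theorem eq_zero_of_abs_eq_zero {x : X} (h : |x| = 0) : x = 0 :=
  le_antisymm ((le_abs_self x).trans h.le) (neg_nonpos.1 ((neg_le_abs x).trans h.le))

variable [Module ℝ X] [IsOrderedModule ℝ X]

theorem abs_smul_le (c : ℝ) (w : X) : |c • w| ≤ |c| • |w| := by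
  have key : ∀ c : ℝ, ∀ w : X, c • w ≤ |c| • |w| := by
    intro c w
    rcases abs_cases c with ⟨h, hc⟩ | ⟨h, hc⟩
    · rw [h]
      exact smul_le_smul_of_nonneg_left (le_abs_self w) hc
    · rw [h, ← neg_smul_neg]
      exact smul_le_smul_of_nonneg_left (neg_le_abs w) (neg_nonneg.2 hc.le)
  refine abs_le'.2 ⟨key c w, ?_⟩
  rw [← smul_neg, ← abs_neg w]
  exact key c (-w)

/-- The order ideal generated by the order ideal `I` and the element `z`. -/
def IsOrderIdeal.adjoin {I : Submodule ℝ X} (_hI : IsOrderIdeal I) (z : X) : Submodule ℝ X where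
  carrier := {w | ∃ m ∈ I, ∃ r : ℝ, 0 ≤ r ∧ |w| ≤ m + r • |z|}
  zero_mem' := ⟨0, I.zero_mem, 0, le_rfl, by simp⟩
  add_mem' := by
    rintro v w ⟨m, hm, r, hr, h⟩ ⟨m', hm', r', hr', h'⟩
    refine ⟨m + m', I.add_mem hm hm', r + r', add_nonneg hr hr', ?_⟩
    calc |v + w| ≤ |v| + |w| := abs_add_le _ _
      _ ≤ (m + r • |z|) + (m' + r' • |z|) := add_le_add h h'
      _ = _ := by module
  smul_mem' := by
    rintro c w ⟨m, hm, r, hr, h⟩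
    refine ⟨|c| • m, I.smul_mem _ hm, |c| * r, mul_nonneg (abs_nonneg _) hr, ?_⟩
    refine (abs_smul_le c w).trans ?_
    calc |c| • |w| ≤ |c| • (m + r • |z|) := smul_le_smul_of_nonneg_left h (abs_nonneg _)
      _ = _ := by module

theorem IsOrderIdeal.mem_adjoin {I : Submodule ℝ X} (hI : IsOrderIdeal I) {z w : X} :
    w ∈ hI.adjoin z ↔ ∃ m ∈ I, ∃ r : ℝ, 0 ≤ r ∧ |w| ≤ m + r • |z| := Iff.rfl

theorem IsOrderIdeal.adjoin_isOrderIdeal {I : Submodule ℝ X} (hI : IsOrderIdeal I) (z : X) :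
    IsOrderIdeal (hI.adjoin z) where
  abs_mem := by
    rintro y ⟨m, hm, r, hr, h⟩
    exact ⟨m, hm, r, hr, by rwa [abs_abs]⟩
  solid := by
    rintro x y hxy ⟨m, hm, r, hr, h⟩
    exact ⟨m, hm, r, hr, hxy.trans h⟩

theorem IsOrderIdeal.le_adjoin {I : Submodule ℝ X} (hI : IsOrderIdeal I) (z : X) :
    I ≤ hI.adjoin z := fun w hw =>
  ⟨|w|, hI.abs_mem w hw, 0, le_rfl, by simp⟩

theorem IsOrderIdeal.self_mem_adjoin {I : Submodule ℝ X} (hI : IsOrderIdeal I) (z : X) :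
    z ∈ hI.adjoin z :=
  ⟨0, I.zero_mem, 1, zero_le_one, by simp⟩

theorem IsOrderIdeal.mem_of_nonneg_of_le {I : Submodule ℝ X} (hI : IsOrderIdeal I) {x y : X}
    (hx : 0 ≤ x) (hxy : x ≤ y) (hy : y ∈ I) : x ∈ I :=
  hI.solid x y (by rwa [abs_of_nonneg hx, abs_of_nonneg (hx.trans hxy)]) hy

theorem IsOrderIdeal.adjoin_le {I J : Submodule ℝ X} (hI : IsOrderIdeal I) (hJ : IsOrderIdeal J)
    (hIJ : I ≤ J) {z : X} (hz : z ∈ J) : hI.adjoin z ≤ J := by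
  rintro w ⟨m, hm, r, hr, h⟩
  refine hJ.solid w (m + r • |z|) (h.trans (le_abs_self _)) ?_
  exact J.add_mem (hIJ hm) (J.smul_mem _ (hJ.abs_mem z hz))

theorem isOrderIdeal_bot : IsOrderIdeal (⊥ : Submodule ℝ X) where
  abs_mem := by simp
  solid := by
    intro x y hxy hy
    rw [Submodule.mem_bot] at hy ⊢
    subst hy
    exact eq_zero_of_abs_eq_zero (le_antisymm (by simpa using hxy) (abs_nonneg x))

theorem idealGen_eq_adjoin (e : X) : idealGen e = isOrderIdeal_bot.adjoin e := by
  refine le_antisymm (sInf_le ⟨isOrderIdeal_bot.adjoin_isOrderIdeal e,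
    isOrderIdeal_bot.self_mem_adjoin e⟩) (le_sInf ?_)
  rintro J ⟨hJ, he⟩
  exact isOrderIdeal_bot.adjoin_le hJ bot_le he

theorem idealGen_isOrderIdeal (e : X) : IsOrderIdeal (idealGen e) := by
  rw [idealGen_eq_adjoin]
  exact isOrderIdeal_bot.adjoin_isOrderIdeal e

theorem self_mem_idealGen (e : X) : e ∈ idealGen e := by
  rw [idealGen_eq_adjoin]
  exact isOrderIdeal_bot.self_mem_adjoin e

theorem mem_idealGen_iff {e x : X} : x ∈ idealGen e ↔ ∃ r : ℝ, 0 ≤ r ∧ |x| ≤ r • |e| := by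
  rw [idealGen_eq_adjoin, IsOrderIdeal.mem_adjoin]
  simp

theorem IsOrderIdeal.sup_mem {I : Submodule ℝ X} (hI : IsOrderIdeal I) {x y : X} (hx : x ∈ I)
    (hy : y ∈ I) : x ⊔ y ∈ I := by
  rw [sup_eq_half_smul_add_add_abs_sub' ℝ]
  exact I.smul_mem _ (I.add_mem (I.add_mem hx hy) (hI.abs_mem _ (I.sub_mem hy hx)))

theorem IsOrderIdeal.inf_mem {I : Submodule ℝ X} (hI : IsOrderIdeal I) {x y : X} (hx : x ∈ I)
    (hy : y ∈ I) : x ⊓ y ∈ I := by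
  rw [eq_sub_of_add_eq (inf_add_sup x y)]
  exact I.sub_mem (I.add_mem hx hy) (hI.sup_mem hx hy)

end VectorLattice

/-! ### Positive products -/

section OrderedAlgebra

variable {A : Type*} [Ring A] [Algebra ℝ A] [Lattice A] [IsOrderedAddMonoid A]

/-- After splitting into positive and negative parts, `|x| * |y| ∓ x * y` is twice a sum of two
products of positive elements. -/
theorem abs_mul_le_of_mul_nonneg (hmul : ∀ x y : A, 0 ≤ x → 0 ≤ y → 0 ≤ x * y) (x y : A) :
    |x * y| ≤ |x| * |y| := by
  have hx := posPart_add_negPart x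
  have hy := posPart_add_negPart y
  have hx' := posPart_sub_negPart x
  have hy' := posPart_sub_negPart y
  have px := posPart_nonneg x
  have nx := negPart_nonneg x
  have py := posPart_nonneg y
  have ny := negPart_nonneg y
  generalize x⁺ = p at *
  generalize x⁻ = q at *
  generalize y⁺ = s at *
  generalize y⁻ = t at *
  rw [← hx, ← hy, ← hx', ← hy']
  refine abs_le'.2 ⟨sub_nonneg.1 ?_, sub_nonneg.1 ?_⟩
  · have : (p + q) * (s + t) - (p - q) * (s - t) = (p * t + q * s) + (p * t + q * s) := by
      noncomm_ring
    rw [this]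
    have := add_nonneg (hmul _ _ px ny) (hmul _ _ nx py)
    exact add_nonneg this this
  · have : (p + q) * (s + t) - -((p - q) * (s - t)) = (p * s + q * t) + (p * s + q * t) := by
      noncomm_ring
    rw [this]
    have := add_nonneg (hmul _ _ px py) (hmul _ _ nx ny)
    exact add_nonneg this this

theorem mul_le_mul_left_of_mul_nonneg (hmul : ∀ x y : A, 0 ≤ x → 0 ≤ y → 0 ≤ x * y)
    {x y z : A} (hz : 0 ≤ z) (h : x ≤ y) : z * x ≤ z * y := by
  have := hmul _ _ hz (sub_nonneg.2 h)
  rwa [mul_sub, sub_nonneg] at this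

theorem mul_le_mul_right_of_mul_nonneg (hmul : ∀ x y : A, 0 ≤ x → 0 ≤ y → 0 ≤ x * y)
    {x y z : A} (hz : 0 ≤ z) (h : x ≤ y) : x * z ≤ y * z := by
  have := hmul _ _ (sub_nonneg.2 h) hz
  rwa [sub_mul, sub_nonneg] at this

theorem mul_le_smul_of_le_smul_one (hmul : ∀ x y : A, 0 ≤ x → 0 ≤ y → 0 ≤ x * y)
    {x y : A} {r : ℝ} (hx : 0 ≤ x) (hy : y ≤ r • 1) : x * y ≤ r • x := by
  simpa using mul_le_mul_left_of_mul_nonneg hmul hx hy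

theorem mul_le_smul_of_le_smul_one' (hmul : ∀ x y : A, 0 ≤ x → 0 ≤ y → 0 ≤ x * y)
    {x y : A} {r : ℝ} (hy : 0 ≤ y) (hx : x ≤ r • 1) : x * y ≤ r • y := by
  simpa using mul_le_mul_right_of_mul_nonneg hmul hy hx

/-- The product lies below a common multiple of `x` and of `y`, so a positive multiple of it lies
below `x ⊓ y`. -/
theorem mul_eq_zero_of_inf_eq_zero [IsOrderedModule ℝ A]
    (hmul : ∀ x y : A, 0 ≤ x → 0 ≤ y → 0 ≤ x * y) {x y : A} {r s : ℝ} (hr : 0 < r)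
    (hx : x ≤ r • 1) (hy : y ≤ s • 1) (h : x ⊓ y = 0) : x * y = 0 := by
  have hx0 : 0 ≤ x := h ▸ inf_le_left
  have hy0 : 0 ≤ y := h ▸ inf_le_right
  have h0 : 0 ≤ x * y := hmul x y hx0 hy0
  set c : ℝ := r ⊔ s
  have hc : 0 < c := lt_sup_of_lt_left hr
  have h1 : x * y ≤ c • x := (mul_le_smul_of_le_smul_one hmul hx0 hy).trans
    (smul_le_smul_of_nonneg_right le_sup_right hx0)
  have h2 : x * y ≤ c • y := (mul_le_smul_of_le_smul_one' hmul hy0 hx).trans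
    (smul_le_smul_of_nonneg_right le_sup_left hy0)
  have h3 : c⁻¹ • (x * y) ≤ 0 := by
    rw [← h]
    exact le_inf ((inv_smul_le_iff_of_pos hc).2 h1) ((inv_smul_le_iff_of_pos hc).2 h2)
  rw [inv_smul_le_iff_of_pos hc, smul_zero] at h3
  exact le_antisymm h3 h0

end OrderedAlgebra

/-! ### The key estimate and the order unit norm -/

section BanachLattice

variable {A : Type*} [NormedRing A] [NormOneClass A] [NormedAlgebra ℝ A]
    [Lattice A] [IsOrderedAddMonoid A] [IsOrderedModule ℝ A] [HasSolidNorm A]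

theorem norm_le_norm_of_nonneg_of_le {x y : A} (hx : 0 ≤ x) (hxy : x ≤ y) : ‖x‖ ≤ ‖y‖ :=
  norm_le_norm_of_abs_le_abs (by rwa [abs_of_nonneg hx, abs_of_nonneg (hx.trans hxy)])

/-- The identity is positive: otherwise the powers of its modulus, which have norm at most one,
would dominate all multiples of its negative part. -/
theorem one_nonneg_of_mul_nonneg (hmul : ∀ x y : A, 0 ≤ x → 0 ≤ y → 0 ≤ x * y) :
    (0 : A) ≤ 1 := by
  have hq : (0 : A) ≤ 1⁻ := negPart_nonneg 1
  have hf : (1 : A)⁺ + 1⁻ = |1| := posPart_add_negPart 1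
  have he : (1 : A)⁺ - 1⁻ = 1 := posPart_sub_negPart 1
  have hf0 : (0 : A) ≤ |1| := abs_nonneg 1
  set q : A := 1⁻
  set f : A := |1| with hfdef
  have hp : (1 : A)⁺ = 1 + q := eq_add_of_sub_eq he
  have hf' : f = 1 + 2 * q := by rw [← hf, hp]; noncomm_ring
  have hfq : q ≤ f * q := by
    rw [hf']
    have : (1 + 2 * q) * q = q + (q * q + q * q) := by noncomm_ring
    rw [this]
    exact le_add_of_nonneg_right (add_nonneg (hmul _ _ hq hq) (hmul _ _ hq hq))
  have hff : f + 2 • q ≤ f * f := by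
    have : f * f = f + 2 • (f * q) := by
      nth_rewrite 2 [hf']
      noncomm_ring
    rw [this]
    gcongr
  -- Since `q ≤ f * q`, each further factor `f` adds at least `2 • q`.
  have key : ∀ n : ℕ, f + (2 * n) • q ≤ f ^ (n + 1) := by
    intro n
    induction n with
    | zero => simp
    | succ n ih =>
      calc f + (2 * (n + 1)) • q = (f + 2 • q) + (2 * n) • q := by
            rw [mul_add, add_smul, mul_one]; abel
        _ ≤ f * f + (2 * n) • (f * q) := by gcongr
        _ = f * (f + (2 * n) • q) := by rw [mul_add, mul_smul_comm]
        _ ≤ f * f ^ (n + 1) := mul_le_mul_left_of_mul_nonneg hmul hf0 ih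
        _ = f ^ (n + 1 + 1) := (pow_succ' _ _).symm
  have hnf : ‖f‖ = 1 := by rw [hfdef, norm_abs_eq_norm, norm_one]
  have hbound : ∀ n : ℕ, (n : ℝ) * ‖q‖ ≤ 1 := by
    intro n
    have h1 : n • q ≤ f ^ (n + 1) := by
      refine le_trans ?_ (key n)
      calc n • q ≤ (2 * n) • q := nsmul_le_nsmul_left hq (by omega)
        _ ≤ _ := le_add_of_nonneg_left hf0
    calc (n : ℝ) * ‖q‖ = ‖n • q‖ := by rw [← Nat.cast_smul_eq_nsmul ℝ, norm_smul]; simp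
      _ ≤ ‖f ^ (n + 1)‖ := norm_le_norm_of_nonneg_of_le (nsmul_nonneg hq n) h1
      _ ≤ ‖f‖ ^ (n + 1) := norm_pow_le _ _
      _ = 1 := by rw [hnf, one_pow]
  have hq0 : q = 0 := by
    by_contra h
    have hpos : 0 < ‖q‖ := norm_pos_iff.2 h
    obtain ⟨n, hn⟩ := exists_nat_gt (1 / ‖q‖)
    rw [div_lt_iff₀ hpos] at hn
    exact absurd (hbound n) (not_le.2 hn)
  rw [← he, hq0, sub_zero]
  exact posPart_nonneg 1

theorem inf_smul_one_le_norm_smul_one (hmul : ∀ x y : A, 0 ≤ x → 0 ≤ y → 0 ≤ x * y)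
    {x : A} (hx : 0 ≤ x) (r : ℝ) : x ⊓ r • 1 ≤ ‖x‖ • 1 := by
  have h1 := one_nonneg_of_mul_nonneg hmul
  wlog hr : 0 < r generalizing r
  · exact (inf_le_inf_left _ (smul_le_smul_of_nonneg_right ((not_lt.1 hr).trans zero_le_one)
      h1)).trans (this 1 one_pos)
  set a := x ⊓ r • (1 : A)
  have ha0 : 0 ≤ a := le_inf hx (smul_nonneg hr.le h1)
  have har : a ≤ r • 1 := inf_le_right
  have hax : ‖a‖ ≤ ‖x‖ := norm_le_norm_of_nonneg_of_le ha0 inf_le_left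
  -- Strict inequality is what makes the norm comparison contradictory; the case `c = ‖x‖` follows
  -- by a limit from the right.
  have key : ∀ c : ℝ, ‖x‖ < c → a ≤ c • 1 := by
    intro c hc
    have hc0 : 0 < c := (norm_nonneg x).trans_lt hc
    set b := a - c • (1 : A) with hb
    have hbp : b⁺ ≤ r • 1 := by
      rw [posPart_def]
      refine sup_le ?_ (smul_nonneg hr.le h1)
      exact (sub_le_self _ (smul_nonneg hc0.le h1)).trans har
    have hbn : b⁻ ≤ c • 1 := by
      rw [negPart_def]
      refine sup_le ?_ (smul_nonneg hc0.le h1)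
      rw [hb, neg_sub]
      exact sub_le_self _ ha0
    have hdisj : b⁻ * b⁺ = 0 :=
      mul_eq_zero_of_inf_eq_zero hmul hc0 hbn hbp (by rw [inf_comm, posPart_inf_negPart_eq_zero])
    have hg := posPart_nonneg b
    -- Multiplying `a = c • 1 + b⁺ - b⁻` by `b⁺` on the right kills the negative part.
    have hbg : c • b⁺ ≤ a * b⁺ := by
      have h2 : a * b⁺ = c • b⁺ + b⁺ * b⁺ := by
        have : a = c • 1 + (b⁺ - b⁻) := by rw [posPart_sub_negPart, hb]; abel
        nth_rewrite 1 [this]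
        rw [add_mul, sub_mul, hdisj, sub_zero, smul_one_mul]
      rw [h2]
      exact le_add_of_nonneg_right (hmul _ _ hg hg)
    have hnorm : c * ‖b⁺‖ ≤ ‖x‖ * ‖b⁺‖ := by
      calc c * ‖b⁺‖ = ‖c • b⁺‖ := by rw [norm_smul, Real.norm_of_nonneg hc0.le]
        _ ≤ ‖a * b⁺‖ := norm_le_norm_of_nonneg_of_le (smul_nonneg hc0.le hg) hbg
        _ ≤ ‖a‖ * ‖b⁺‖ := norm_mul_le _ _
        _ ≤ _ := by gcongr
    have hz : b⁺ = 0 := by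
      by_contra h
      exact absurd (le_of_mul_le_mul_right hnorm (norm_pos_iff.2 h)) (not_le.2 hc)
    rw [posPart_eq_zero, hb, sub_nonpos] at hz
    exact hz
  have hlim : Filter.Tendsto (fun c : ℝ => c • (1 : A)) (nhdsWithin ‖x‖ (Set.Ioi ‖x‖))
      (nhds (‖x‖ • 1)) :=
    ((continuous_id.smul continuous_const).tendsto _).mono_left nhdsWithin_le_nhds
  exact ge_of_tendsto hlim (Filter.eventually_of_mem self_mem_nhdsWithin key)

theorem mem_idealGen_one_iff (hmul : ∀ x y : A, 0 ≤ x → 0 ≤ y → 0 ≤ x * y) {x : A} :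
    x ∈ idealGen (1 : A) ↔ ∃ r : ℝ, |x| ≤ r • 1 := by
  have h1 := one_nonneg_of_mul_nonneg hmul
  rw [mem_idealGen_iff, abs_of_nonneg h1]
  exact ⟨fun ⟨r, _, h⟩ => ⟨r, h⟩, fun ⟨r, h⟩ => ⟨|r|, abs_nonneg r, h.trans
    (smul_le_smul_of_nonneg_right (le_abs_self r) h1)⟩⟩

theorem abs_le_norm_smul_one (hmul : ∀ x y : A, 0 ≤ x → 0 ≤ y → 0 ≤ x * y) {x : A}
    (hx : x ∈ idealGen (1 : A)) : |x| ≤ ‖x‖ • 1 := by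
  obtain ⟨r, hr⟩ := (mem_idealGen_one_iff hmul).1 hx
  have := inf_smul_one_le_norm_smul_one hmul (abs_nonneg x) r
  rwa [inf_eq_left.2 hr, norm_abs_eq_norm] at this

theorem norm_le_of_abs_le_smul_one {x : A} {r : ℝ} (hr : 0 ≤ r) (hx : |x| ≤ r • 1) :
    ‖x‖ ≤ r := by
  calc ‖x‖ ≤ ‖r • (1 : A)‖ := norm_le_norm_of_abs_le_abs (hx.trans (le_abs_self _))
    _ = r := by rw [norm_smul, norm_one, mul_one, Real.norm_of_nonneg hr]

theorem unitNorm_one_eq_norm (hmul : ∀ x y : A, 0 ≤ x → 0 ≤ y → 0 ≤ x * y) {x : A}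
    (hx : x ∈ idealGen (1 : A)) : unitNorm (1 : A) x = ‖x‖ := by
  have h1 := one_nonneg_of_mul_nonneg hmul
  refine csInf_eq_of_forall_ge_of_forall_gt_exists_lt ?_ ?_ ?_
  · exact ⟨‖x‖ + 1, by positivity, (abs_le_norm_smul_one hmul hx).trans
      (smul_le_smul_of_nonneg_right (by linarith) h1)⟩
  · rintro r ⟨hr, h⟩
    exact norm_le_of_abs_le_smul_one hr.le h
  · intro w hw
    -- The midpoint rather than `‖x‖` itself, because `r` must be strictly positive and `x` may be
    -- zero.
    refine ⟨(‖x‖ + w) / 2, ⟨?_, (abs_le_norm_smul_one hmul hx).trans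
      (smul_le_smul_of_nonneg_right (by linarith) h1)⟩, by linarith⟩
    have := norm_nonneg x
    linarith

theorem isClosed_idealGen_one (hmul : ∀ x y : A, 0 ≤ x → 0 ≤ y → 0 ≤ x * y) :
    IsClosed (idealGen (1 : A) : Set A) := by
  have : (idealGen (1 : A) : Set A) = {x | |x| ≤ ‖x‖ • 1} := by
    ext x
    exact ⟨abs_le_norm_smul_one hmul, fun h => (mem_idealGen_one_iff hmul).2 ⟨_, h⟩⟩
  rw [this]
  refine isClosed_le ?_ (by fun_prop)
  exact continuous_id.sup continuous_neg

/-- The order ideal generated by the identity, as a subalgebra. -/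
noncomputable def idealGenOne (hmul : ∀ x y : A, 0 ≤ x → 0 ≤ y → 0 ≤ x * y) : Subalgebra ℝ A :=
  (idealGen (1 : A)).toSubalgebra (self_mem_idealGen 1) (by
    intro x y hx hy
    refine (mem_idealGen_one_iff hmul).2 ⟨‖x‖ * ‖y‖, ?_⟩
    calc |x * y| ≤ |x| * |y| := abs_mul_le_of_mul_nonneg hmul x y
      _ ≤ ‖y‖ • |x| :=
        mul_le_smul_of_le_smul_one hmul (abs_nonneg x) (abs_le_norm_smul_one hmul hy)
      _ ≤ ‖y‖ • ‖x‖ • 1 :=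
        smul_le_smul_of_nonneg_left (abs_le_norm_smul_one hmul hx) (norm_nonneg y)
      _ = _ := by rw [smul_smul, mul_comm])

theorem idealGenOne_isBanachLatticeAlgebra [CompleteSpace A]
    (hmul : ∀ x y : A, 0 ≤ x → 0 ≤ y → 0 ≤ x * y) :
    IsBanachLatticeAlgebra (idealGenOne hmul) (unitNorm (1 : A)) := by
  have hN : ∀ x ∈ idealGenOne hmul, unitNorm (1 : A) x = ‖x‖ :=
    fun x hx => unitNorm_one_eq_norm hmul hx
  have hI := idealGen_isOrderIdeal (1 : A)
  constructor
  · exact fun x hx y hy => hI.sup_mem hx hy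
  · exact fun x hx y hy => hI.inf_mem hx hy
  · exact fun x hx => hN x hx ▸ norm_nonneg x
  · exact fun x hx => hN x hx ▸ _root_.norm_eq_zero
  · intro r x hx
    rw [hN _ (Subalgebra.smul_mem _ hx r), hN x hx, _root_.norm_smul, Real.norm_eq_abs]
  · intro x hx y hy
    rw [hN _ (add_mem hx hy), hN x hx, hN y hy]
    exact _root_.norm_add_le x y
  · intro x hx y hy h
    rw [hN x hx, hN y hy]
    exact norm_le_norm_of_abs_le_abs h
  · intro u hu hc
    have hcauchy : CauchySeq u := by
      refine Metric.cauchySeq_iff.2 fun ε hε => ?_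
      obtain ⟨n₀, hn₀⟩ := hc ε hε
      refine ⟨n₀, fun m hm n hn => ?_⟩
      rw [dist_eq_norm, ← hN _ (sub_mem (hu m) (hu n))]
      exact hn₀ m hm n hn
    obtain ⟨x, hx⟩ := cauchySeq_tendsto_of_complete hcauchy
    have hxB : x ∈ idealGenOne hmul :=
      (isClosed_idealGen_one hmul).mem_of_tendsto hx (Filter.Eventually.of_forall hu)
    refine ⟨x, hxB, ?_⟩
    simp_rw [fun n => hN _ (sub_mem (hu n) hxB)]
    exact tendsto_iff_norm_sub_tendsto_zero.1 hx
  · intro x hx y hy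
    rw [hN _ (mul_mem hx hy), hN x hx, hN y hy]
    exact _root_.norm_mul_le x y
  · exact fun x _ y _ hx hy => hmul x y hx hy
  · rw [hN 1 (one_mem _), NormOneClass.norm_one]

end BanachLattice

/-! ### Disjoint complements -/

section DisjointComplement

variable {X : Type*} [AddCommGroup X] [Lattice X] [IsOrderedAddMonoid X] [Module ℝ X]

theorem sub_mem_disjointCompl {B : Submodule ℝ X} {x y : X} (hx : x ∈ disjointCompl B)
    (hy : y ∈ disjointCompl B) : x - y ∈ disjointCompl B := by
  intro z hz
  refine le_antisymm ?_ (le_inf (abs_nonneg _) (abs_nonneg _))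
  calc |x - y| ⊓ |z| ≤ (|x| + |y|) ⊓ |z| := inf_le_inf_right _ (by
        rw [sub_eq_add_neg, ← abs_neg y]
        exact abs_add_le x (-y))
    _ ≤ |x| ⊓ |z| + |y| ⊓ |z| :=
      add_inf_le_inf_add_inf (abs_nonneg _) (abs_nonneg _) (abs_nonneg _)
    _ = 0 := by rw [hx z hz, hy z hz, add_zero]

theorem eq_zero_of_mem_of_mem_disjointCompl {B : Submodule ℝ X} {x : X} (hx : x ∈ B)
    (hx' : x ∈ disjointCompl B) : x = 0 :=
  eq_zero_of_abs_eq_zero (by simpa using hx' x hx)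

end DisjointComplement

/-! ### Band projection and inverse closedness -/

section Band

variable {A : Type*} [NormedRing A] [NormOneClass A] [NormedAlgebra ℝ A]
    [Lattice A] [IsOrderedAddMonoid A] [IsOrderedModule ℝ A] [HasSolidNorm A]

theorem inf_smul_one_le_inf_norm_smul_one (hmul : ∀ x y : A, 0 ≤ x → 0 ≤ y → 0 ≤ x * y)
    {x : A} (hx : 0 ≤ x) (r : ℝ) : x ⊓ r • 1 ≤ x ⊓ ‖x‖ • 1 :=
  le_inf inf_le_left (inf_smul_one_le_norm_smul_one hmul hx r)

theorem inf_norm_smul_one_mem (hmul : ∀ x y : A, 0 ≤ x → 0 ≤ y → 0 ≤ x * y)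
    {x : A} (hx : 0 ≤ x) : x ⊓ ‖x‖ • 1 ∈ idealGen (1 : A) := by
  have h1 := one_nonneg_of_mul_nonneg hmul
  refine (mem_idealGen_one_iff hmul).2 ⟨‖x‖, ?_⟩
  rw [abs_of_nonneg (le_inf hx (smul_nonneg (norm_nonneg x) h1))]
  exact inf_le_right

theorem sub_inf_norm_smul_one_mem (hmul : ∀ x y : A, 0 ≤ x → 0 ≤ y → 0 ≤ x * y)
    {x : A} (hx : 0 ≤ x) : x - x ⊓ ‖x‖ • 1 ∈ disjointCompl (idealGen (1 : A)) := by
  intro y hy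
  obtain ⟨r, hr⟩ := (mem_idealGen_one_iff hmul).1 hy
  refine le_antisymm ?_ (le_inf (abs_nonneg _) (abs_nonneg _))
  rw [abs_of_nonneg (sub_nonneg.2 inf_le_left)]
  refine (inf_le_inf_left _ hr).trans ?_
  -- Adding `x ⊓ ‖x‖ • 1` to the meet yields something below the truncation of `x` at `(r + ‖x‖) •
  -- 1`, which the key estimate bounds by `x ⊓ ‖x‖ • 1` again.
  refine (add_le_iff_nonpos_left (b := x ⊓ ‖x‖ • (1 : A))).1 ?_
  rw [inf_add, sub_add_cancel]
  refine le_trans (inf_le_inf_left _ ?_) (inf_smul_one_le_inf_norm_smul_one hmul hx (r + ‖x‖))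
  rw [add_smul]
  exact add_le_add_right inf_le_right _

theorem exists_add_disjointCompl (hmul : ∀ x y : A, 0 ≤ x → 0 ≤ y → 0 ≤ x * y) (x : A) :
    ∃ b ∈ idealGen (1 : A), ∃ d ∈ disjointCompl (idealGen (1 : A)), x = b + d := by
  have hp := posPart_nonneg x
  have hn := negPart_nonneg x
  refine ⟨_, sub_mem (inf_norm_smul_one_mem hmul hp) (inf_norm_smul_one_mem hmul hn), _,
    sub_mem_disjointCompl (sub_inf_norm_smul_one_mem hmul hp)
      (sub_inf_norm_smul_one_mem hmul hn), ?_⟩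
  nth_rewrite 1 [← posPart_sub_negPart x]
  abel

theorem idealGen_one_isBand (hmul : ∀ x y : A, 0 ≤ x → 0 ≤ y → 0 ≤ x * y) :
    IsBand (idealGen (1 : A)) where
  isOrderIdeal := idealGen_isOrderIdeal 1
  sup_mem := by
    rintro S x hS ⟨s, hs⟩ hdir hx
    have hy : 0 ≤ x - s := sub_nonneg.2 (hx.1 hs)
    have hmem := inf_norm_smul_one_mem hmul hy
    -- For `t ∈ S` above `s`, the difference `t - s` lies in the ideal and below `x - s`, hence
    -- below the truncation of `x - s`. Directedness makes the right side an upper bound of all of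
    -- `S`.
    have hle : x ≤ s + (x - s) ⊓ ‖x - s‖ • 1 := by
      refine hx.2 fun v hv => ?_
      obtain ⟨t, ht, hvt, hst⟩ := hdir v hv s hs
      obtain ⟨r, hr⟩ := (mem_idealGen_one_iff hmul).1 (sub_mem (hS ht) (hS hs))
      refine hvt.trans (sub_le_iff_le_add'.1 ?_)
      exact (le_inf (sub_le_sub_right (hx.1 ht) s) ((le_abs_self _).trans hr)).trans
        (inf_smul_one_le_inf_norm_smul_one hmul hy r)
    have := (idealGen_isOrderIdeal (1 : A)).mem_of_nonneg_of_le hy (sub_le_iff_le_add'.2 hle) hmem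
    simpa using add_mem this (hS hs)

theorem idealGen_one_isProjectionBand (hmul : ∀ x y : A, 0 ≤ x → 0 ≤ y → 0 ≤ x * y) :
    IsProjectionBand (idealGen (1 : A)) where
  isBand := idealGen_one_isBand hmul
  decomp := by
    intro x
    obtain ⟨b, hb, d, hd, rfl⟩ := exists_add_disjointCompl hmul x
    refine ⟨(b, d), ⟨hb, hd, rfl⟩, ?_⟩
    rintro ⟨b', d'⟩ ⟨hb', hd', h⟩
    have hbd : b' - b = d - d' := by
      rw [sub_eq_sub_iff_add_eq_add, ← h, add_comm]
    have h0 : b' - b = 0 := eq_zero_of_mem_of_mem_disjointCompl (sub_mem hb' hb)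
      (hbd ▸ sub_mem_disjointCompl hd hd')
    rw [h0] at hbd
    rw [sub_eq_zero.1 h0, sub_eq_zero.1 hbd.symm]

theorem idealGen_one_eq_bandGen (hmul : ∀ x y : A, 0 ≤ x → 0 ≤ y → 0 ≤ x * y) :
    idealGen (1 : A) = bandGen (1 : A) := by
  refine le_antisymm (le_sInf ?_) (sInf_le ⟨idealGen_one_isBand hmul, self_mem_idealGen 1⟩)
  rintro B ⟨hB, h1⟩
  exact sInf_le ⟨hB.isOrderIdeal, h1⟩

theorem mul_mem_disjointCompl (hmul : ∀ x y : A, 0 ≤ x → 0 ≤ y → 0 ≤ x * y) {a d : A}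
    (ha : a ∈ idealGen (1 : A)) (hd : d ∈ disjointCompl (idealGen (1 : A))) :
    a * d ∈ disjointCompl (idealGen (1 : A)) := by
  intro y hy
  -- The summand `1` gives both `0 < r`, for dividing, and `|y| ≤ r • |y|`.
  set r := ‖a‖ + 1
  have hr : 0 < r := by positivity
  have hr1 : 1 ≤ r := le_add_of_nonneg_left (norm_nonneg a)
  have h1 := one_nonneg_of_mul_nonneg hmul
  have hle : |a * d| ≤ r • |d| := by
    refine (abs_mul_le_of_mul_nonneg hmul a d).trans
      (mul_le_smul_of_le_smul_one' hmul (abs_nonneg d) ?_)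
    exact (abs_le_norm_smul_one hmul ha).trans (smul_le_smul_of_nonneg_right (by simp [r]) h1)
  refine le_antisymm ?_ (le_inf (abs_nonneg _) (abs_nonneg _))
  have : r⁻¹ • (|a * d| ⊓ |y|) ≤ 0 := by
    rw [← hd y hy]
    refine le_inf ((inv_smul_le_iff_of_pos hr).2 (inf_le_left.trans hle))
      ((inv_smul_le_iff_of_pos hr).2 (inf_le_right.trans ?_))
    simpa using smul_le_smul_of_nonneg_right hr1 (abs_nonneg y)
  rwa [inv_smul_le_iff_of_pos hr, smul_zero] at this

theorem idealGenOne_isInverseClosed (hmul : ∀ x y : A, 0 ≤ x → 0 ≤ y → 0 ≤ x * y) :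
    IsInverseClosed (idealGenOne hmul) := by
  intro u hu
  obtain ⟨b, hb, d, hd, h⟩ := exists_add_disjointCompl hmul ((u⁻¹ : Aˣ) : A)
  have h1 : (u : A) * b + u * d = 1 := by rw [← mul_add, ← h, Units.mul_inv]
  have h2 : (u : A) * d ∈ idealGenOne hmul := by
    rw [eq_sub_of_add_eq' h1]
    exact sub_mem (one_mem _) (mul_mem hu hb)
  have h3 : (u : A) * d = 0 :=
    eq_zero_of_mem_of_mem_disjointCompl h2 (mul_mem_disjointCompl hmul hu hd)
  rw [Units.mul_right_eq_zero] at h3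
  rw [h, h3, add_zero]
  exact hb

end Band

/-! ### Lattice characters from maximal order ideals -/

section Characters

/-- The real-valued unital algebra homomorphisms on `B` that preserve suprema. -/
def latticeCharacters {A : Type*} [Ring A] [Algebra ℝ A] [Lattice A] (B : Subalgebra ℝ A) :
    Set (B → ℝ) :=
  {f | f 1 = 1 ∧ (∀ x y, f (x + y) = f x + f y) ∧ (∀ x y, f (x * y) = f x * f y) ∧
    (∀ (r : ℝ) (x), f (r • x) = r * f x) ∧
    ∀ x y z : B, (z : A) = (x : A) ⊔ (y : A) → f z = f x ⊔ f y}

theorem isClosed_latticeCharacters {A : Type*} [Ring A] [Algebra ℝ A] [Lattice A]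
    (B : Subalgebra ℝ A) : IsClosed (latticeCharacters B) := by
  have : latticeCharacters B = {f | f 1 = 1} ∩ ({f | ∀ x y, f (x + y) = f x + f y} ∩
      ({f | ∀ x y, f (x * y) = f x * f y} ∩ ({f | ∀ (r : ℝ) (x), f (r • x) = r * f x} ∩
      {f | ∀ x y z : B, (z : A) = (x : A) ⊔ (y : A) → f z = f x ⊔ f y}))) := rfl
  rw [this]
  simp only [Set.ofPred_forall]
  refine IsClosed.inter ?_ (IsClosed.inter ?_ (IsClosed.inter ?_ (IsClosed.inter ?_ ?_)))
  · exact isClosed_eq (by fun_prop) (by fun_prop)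
  · exact isClosed_iInter fun _ => isClosed_iInter fun _ =>
      isClosed_eq (by fun_prop) (by fun_prop)
  · exact isClosed_iInter fun _ => isClosed_iInter fun _ =>
      isClosed_eq (by fun_prop) (by fun_prop)
  · exact isClosed_iInter fun _ => isClosed_iInter fun _ =>
      isClosed_eq (by fun_prop) (by fun_prop)
  · exact isClosed_iInter fun _ => isClosed_iInter fun _ => isClosed_iInter fun _ =>
      isClosed_iInter fun _ => isClosed_eq (by fun_prop) (by fun_prop)

theorem latticeCharacters_mono {A : Type*} [Ring A] [Algebra ℝ A] [Lattice A]
    {B : Subalgebra ℝ A} {f : B → ℝ} (hf : f ∈ latticeCharacters B) {x y : B}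
    (h : (x : A) ≤ y) : f x ≤ f y := by
  rw [hf.2.2.2.2 x y y (sup_eq_right.2 h).symm]
  exact le_sup_left

theorem latticeCharacters_smul_one {A : Type*} [Ring A] [Algebra ℝ A] [Lattice A]
    {B : Subalgebra ℝ A} {f : B → ℝ} (hf : f ∈ latticeCharacters B) (r : ℝ) :
    f (r • 1) = r := by
  rw [hf.2.2.2.1, hf.1, mul_one]

variable {A : Type*} [NormedRing A] [NormOneClass A] [NormedAlgebra ℝ A]
    [Lattice A] [IsOrderedAddMonoid A] [IsOrderedModule ℝ A] [HasSolidNorm A]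

theorem abs_latticeCharacters_le (hmul : ∀ x y : A, 0 ≤ x → 0 ≤ y → 0 ≤ x * y)
    {f : idealGenOne hmul → ℝ} (hf : f ∈ latticeCharacters (idealGenOne hmul))
    (x : idealGenOne hmul) : |f x| ≤ ‖(x : A)‖ := by
  have hx := abs_le_norm_smul_one hmul x.2
  have h1 : f x ≤ f (‖(x : A)‖ • 1) := latticeCharacters_mono hf ((le_abs_self _).trans hx)
  have h2 : f ((-1 : ℝ) • x) ≤ f (‖(x : A)‖ • 1) := latticeCharacters_mono hf (by
    have : (((-1 : ℝ) • x : idealGenOne hmul) : A) = -(x : A) := by simp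
    rw [this]
    exact (neg_le_abs _).trans hx)
  rw [latticeCharacters_smul_one hf] at h1 h2
  rw [hf.2.2.2.1] at h2
  exact abs_le'.2 ⟨h1, by linarith⟩

/-- Tychonoff: the characters form a closed subset of a product of the intervals `[-‖x‖, ‖x‖]`. -/
theorem isCompact_latticeCharacters (hmul : ∀ x y : A, 0 ≤ x → 0 ≤ y → 0 ≤ x * y) :
    IsCompact (latticeCharacters (idealGenOne hmul)) := by
  refine IsCompact.of_isClosed_subset
    (isCompact_univ_pi fun x : idealGenOne hmul => isCompact_Icc (a := -‖(x : A)‖) (b := ‖(x : A)‖))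
    (isClosed_latticeCharacters _) fun f hf x _ => ?_
  exact abs_le.1 (abs_latticeCharacters_le hmul hf x)

/-- Zorn's lemma. The last clause is maximality made explicit: adjoining `z ∉ M` produces an order
ideal containing `1`. -/
theorem exists_maximal_orderIdeal {I : Submodule ℝ A} (hI : IsOrderIdeal I)
    (hle : I ≤ idealGen (1 : A)) (h1 : (1 : A) ∉ I) :
    ∃ M : Submodule ℝ A, I ≤ M ∧ IsOrderIdeal M ∧ M ≤ idealGen (1 : A) ∧ (1 : A) ∉ M ∧
      ∀ z ∈ idealGen (1 : A), z ∉ M → ∃ m ∈ M, ∃ r : ℝ, 0 ≤ r ∧ 1 ≤ m + r • |z| := by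
  obtain ⟨M, hIM, hM⟩ := zorn_le_nonempty₀
    {J : Submodule ℝ A | IsOrderIdeal J ∧ J ≤ idealGen (1 : A) ∧ (1 : A) ∉ J} (by
      intro c hc hchain J hJ
      have hmem : ∀ x, x ∈ sSup c ↔ ∃ y ∈ c, x ∈ y := fun x =>
        Submodule.mem_sSup_of_directed ⟨J, hJ⟩ hchain.directedOn
      refine ⟨sSup c, ⟨⟨?_, ?_⟩, sSup_le fun L hL => (hc hL).2.1, ?_⟩, fun z hz => le_sSup hz⟩
      · intro y hy
        obtain ⟨L, hL, hyL⟩ := (hmem y).1 hy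
        exact (hmem _).2 ⟨L, hL, (hc hL).1.abs_mem y hyL⟩
      · intro x y hxy hy
        obtain ⟨L, hL, hyL⟩ := (hmem y).1 hy
        exact (hmem _).2 ⟨L, hL, (hc hL).1.solid x y hxy hyL⟩
      · intro h
        obtain ⟨L, hL, h1L⟩ := (hmem 1).1 h
        exact (hc hL).2.2 h1L) I ⟨hI, hle, h1⟩
  obtain ⟨hMI, hMle, hM1⟩ := hM.prop
  refine ⟨M, hIM, hMI, hMle, hM1, fun z hz hzM => ?_⟩
  by_contra hcon
  refine hzM (hM.le_of_ge (y := hMI.adjoin z) ⟨hMI.adjoin_isOrderIdeal z,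
    hMI.adjoin_le (idealGen_isOrderIdeal 1) hMle hz, ?_⟩ (hMI.le_adjoin z)
    (hMI.self_mem_adjoin z))
  rintro ⟨m, hm, r, hr, h⟩
  exact hcon ⟨m, hm, r, hr, (le_abs_self _).trans h⟩

theorem IsOrderIdeal.mul_mem_left (hmul : ∀ x y : A, 0 ≤ x → 0 ≤ y → 0 ≤ x * y)
    {M : Submodule ℝ A} (hM : IsOrderIdeal M) {b m : A} (hb : b ∈ idealGen (1 : A))
    (hm : m ∈ M) : b * m ∈ M := by
  refine hM.solid _ (‖b‖ • |m|) ?_ (M.smul_mem _ (hM.abs_mem m hm))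
  exact ((abs_mul_le_of_mul_nonneg hmul b m).trans (mul_le_smul_of_le_smul_one' hmul
    (abs_nonneg m) (abs_le_norm_smul_one hmul hb))).trans (le_abs_self _)

theorem IsOrderIdeal.mul_mem_right (hmul : ∀ x y : A, 0 ≤ x → 0 ≤ y → 0 ≤ x * y)
    {M : Submodule ℝ A} (hM : IsOrderIdeal M) {b m : A} (hb : b ∈ idealGen (1 : A))
    (hm : m ∈ M) : m * b ∈ M := by
  refine hM.solid _ (‖b‖ • |m|) ?_ (M.smul_mem _ (hM.abs_mem m hm))
  exact ((abs_mul_le_of_mul_nonneg hmul m b).trans (mul_le_smul_of_le_smul_one hmul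
    (abs_nonneg m) (abs_le_norm_smul_one hmul hb))).trans (le_abs_self _)

theorem posPart_mem_idealGen {e z : A} (hz : z ∈ idealGen e) : z⁺ ∈ idealGen e :=
  (idealGen_isOrderIdeal e).sup_mem hz (zero_mem _)

theorem negPart_mem_idealGen {e z : A} (hz : z ∈ idealGen e) : z⁻ ∈ idealGen e :=
  (idealGen_isOrderIdeal e).sup_mem (neg_mem hz) (zero_mem _)

theorem negPart_mul_posPart_eq_zero (hmul : ∀ x y : A, 0 ≤ x → 0 ≤ y → 0 ≤ x * y) {z : A}
    (hz : z ∈ idealGen (1 : A)) : z⁻ * z⁺ = 0 := by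
  have h1 := one_nonneg_of_mul_nonneg hmul
  have hle : |z| ≤ (‖z‖ + 1) • 1 := (abs_le_norm_smul_one hmul hz).trans
    (smul_le_smul_of_nonneg_right (by simp) h1)
  rw [← posPart_add_negPart] at hle
  exact mul_eq_zero_of_inf_eq_zero hmul (r := ‖z‖ + 1) (s := ‖z‖ + 1) (by positivity)
    ((le_add_of_nonneg_left (posPart_nonneg z)).trans hle)
    ((le_add_of_nonneg_right (negPart_nonneg z)).trans hle)
    (by rw [inf_comm, posPart_inf_negPart_eq_zero])

/-- The quotient by `M` is totally ordered: multiplying `1 ≤ m + r • z⁺` by `z⁻` leaves `z⁻ ≤ z⁻ *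
m`, which is in `M`. -/
theorem negPart_mem_of_posPart_notMem (hmul : ∀ x y : A, 0 ≤ x → 0 ≤ y → 0 ≤ x * y)
    {M : Submodule ℝ A} (hM : IsOrderIdeal M)
    (hmax : ∀ z ∈ idealGen (1 : A), z ∉ M → ∃ m ∈ M, ∃ r : ℝ, 0 ≤ r ∧ 1 ≤ m + r • |z|)
    {z : A} (hz : z ∈ idealGen (1 : A)) (h : z⁺ ∉ M) : z⁻ ∈ M := by
  obtain ⟨m, hm, r, hr, hle⟩ := hmax _ (posPart_mem_idealGen hz) h
  have h2 := mul_le_mul_left_of_mul_nonneg hmul (negPart_nonneg z) hle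
  rw [abs_of_nonneg (posPart_nonneg z), mul_one, mul_add, mul_smul_comm,
    negPart_mul_posPart_eq_zero hmul hz, smul_zero, add_zero] at h2
  exact hM.mem_of_nonneg_of_le (negPart_nonneg z) h2
    (hM.mul_mem_left hmul (negPart_mem_idealGen hz) hm)

/-- The quotient by `M` is one-dimensional. The scalar `r` is a Dedekind cut: the infimum of all `s`
with `y ≤ s • 1` modulo `M`. -/
theorem exists_sub_smul_one_mem (hmul : ∀ x y : A, 0 ≤ x → 0 ≤ y → 0 ≤ x * y)
    {M : Submodule ℝ A} (hM : IsOrderIdeal M) (hM1 : (1 : A) ∉ M)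
    (hmax : ∀ z ∈ idealGen (1 : A), z ∉ M → ∃ m ∈ M, ∃ r : ℝ, 0 ≤ r ∧ 1 ≤ m + r • |z|)
    {y : A} (hy : y ∈ idealGen (1 : A)) : ∃ r : ℝ, y - r • 1 ∈ M := by
  have h1 := one_nonneg_of_mul_nonneg hmul
  have hyn := abs_le_norm_smul_one hmul hy
  have hmem : ∀ s : ℝ, y - s • 1 ∈ idealGen (1 : A) := fun s =>
    sub_mem hy (Submodule.smul_mem _ s (self_mem_idealGen 1))
  have hone : ∀ (c : ℝ), 0 < c → ∀ m ∈ M, c • 1 ≤ m → False := by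
    intro c hc m hm hcm
    have := hM.mem_of_nonneg_of_le (smul_nonneg hc.le h1) hcm hm
    exact hM1 ((Submodule.smul_mem_iff M hc.ne').1 this)
  set S : Set ℝ := {s | (y - s • (1 : A))⁺ ∈ M} with hS
  have hSne : S.Nonempty := by
    refine ⟨‖y‖, ?_⟩
    have : (y - ‖y‖ • (1 : A))⁺ = 0 := by
      rw [posPart_eq_zero, sub_nonpos]
      exact (le_abs_self y).trans hyn
    rw [hS, Set.mem_ofPred_eq, this]
    exact M.zero_mem
  have hSbdd : BddBelow S := by
    refine ⟨-‖y‖, fun s hs => ?_⟩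
    by_contra! hlt
    refine hone (-‖y‖ - s) (by linarith) _ hs (le_trans ?_ (le_posPart _))
    rw [sub_smul, neg_smul]
    exact sub_le_sub_right (neg_le.1 ((neg_le_abs y).trans hyn)) _
  set r := sInf S
  have hup : ∀ ε : ℝ, 0 < ε → (y - (r + ε) • (1 : A))⁺ ∈ M := by
    intro ε hε
    obtain ⟨s, hs, hsr⟩ := exists_lt_of_csInf_lt hSne (lt_add_of_pos_right r hε)
    refine hM.mem_of_nonneg_of_le (posPart_nonneg _) (posPart_mono ?_) hs
    exact sub_le_sub_left (smul_le_smul_of_nonneg_right hsr.le h1) _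
  have hlow : ∀ ε : ℝ, 0 < ε → (y - (r - ε) • (1 : A))⁻ ∈ M := by
    intro ε hε
    refine negPart_mem_of_posPart_notMem hmul hM hmax (hmem _) fun h => ?_
    have := csInf_le hSbdd (show r - ε ∈ S from h)
    change r ≤ r - ε at this
    linarith
  refine ⟨r, ?_⟩
  by_contra hw
  obtain ⟨m, hm, n, hn, hle⟩ := hmax _ (hmem r) hw
  -- Modulo `M`, `|y - r • 1|` is at most `2ε`, so this choice leaves `(1 / 2) • 1` below an element
  -- of `M`. The `n + 1` covers `n = 0`.
  set ε : ℝ := 1 / (4 * (n + 1)) with hε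
  have hε0 : 0 < ε := by positivity
  have hnε : n * ε ≤ 1 / 4 := by
    rw [hε, mul_one_div, div_le_div_iff₀ (by positivity) (by norm_num)]
    linarith
  have hp : (y - r • (1 : A))⁺ ≤ (y - (r + ε) • (1 : A))⁺ + ε • 1 := by
    refine sup_le ?_ (add_nonneg (posPart_nonneg _) (smul_nonneg hε0.le h1))
    calc y - r • (1 : A) = (y - (r + ε) • (1 : A)) + ε • 1 := by module
      _ ≤ _ := add_le_add_left (le_posPart _) _
  have hq : (y - r • (1 : A))⁻ ≤ (y - (r - ε) • (1 : A))⁻ + ε • 1 := by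
    refine sup_le ?_ (add_nonneg (negPart_nonneg _) (smul_nonneg hε0.le h1))
    calc -(y - r • (1 : A)) = -(y - (r - ε) • (1 : A)) + ε • 1 := by module
      _ ≤ _ := add_le_add_left (neg_le_negPart _) _
  set u := (y - (r + ε) • (1 : A))⁺
  set v := (y - (r - ε) • (1 : A))⁻
  refine hone (1 / 2) (by norm_num) (m + n • (u + v)) (M.add_mem hm (M.smul_mem _
    (M.add_mem (hup ε hε0) (hlow ε hε0)))) ?_
  have hbig : (1 : A) ≤ (m + n • (u + v)) + (1 / 2 : ℝ) • 1 := by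
    calc (1 : A) ≤ m + n • |y - r • (1 : A)| := hle
      _ = m + n • ((y - r • (1 : A))⁺ + (y - r • (1 : A))⁻) := by rw [posPart_add_negPart]
      _ ≤ m + n • ((u + ε • 1) + (v + ε • 1)) :=
        add_le_add_right (smul_le_smul_of_nonneg_left (add_le_add hp hq) hn) _
      _ = (m + n • (u + v)) + (2 * (n * ε)) • 1 := by module
      _ ≤ _ := add_le_add_right (smul_le_smul_of_nonneg_right (by linarith) h1) _
  calc (1 / 2 : ℝ) • (1 : A) = 1 - (1 / 2 : ℝ) • 1 := by module
    _ ≤ _ := sub_le_iff_le_add.2 hbig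

theorem smul_one_sup_smul_one (hmul : ∀ x y : A, 0 ≤ x → 0 ≤ y → 0 ≤ x * y) (a b : ℝ) :
    a • (1 : A) ⊔ b • 1 = (a ⊔ b) • 1 := by
  have h1 := one_nonneg_of_mul_nonneg hmul
  rcases le_total a b with h | h
  · rw [sup_eq_right.2 h, sup_eq_right.2 (smul_le_smul_of_nonneg_right h h1)]
  · rw [sup_eq_left.2 h, sup_eq_left.2 (smul_le_smul_of_nonneg_right h h1)]

/-- The value `f x` is the unique `r` with `x - r • 1 ∈ M`, for a maximal `M` containing `I`. Every
identity for `f` follows from uniqueness, as `M` is solid and absorbs products with elements of the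
ideal. -/
theorem exists_latticeCharacter_vanishing (hmul : ∀ x y : A, 0 ≤ x → 0 ≤ y → 0 ≤ x * y)
    {I : Submodule ℝ A} (hI : IsOrderIdeal I) (hle : I ≤ idealGen (1 : A)) (h1 : (1 : A) ∉ I) :
    ∃ f ∈ latticeCharacters (idealGenOne hmul), ∀ x : idealGenOne hmul, (x : A) ∈ I → f x = 0 := by
  obtain ⟨M, hIM, hM, hMle, hM1, hmax⟩ := exists_maximal_orderIdeal hI hle h1
  choose f hf using fun x : idealGenOne hmul => exists_sub_smul_one_mem hmul hM hM1 hmax x.2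
  have huniq : ∀ (x : idealGenOne hmul) (r : ℝ), (x : A) - r • 1 ∈ M → f x = r := by
    intro x r hr
    by_contra hne
    refine hM1 ((Submodule.smul_mem_iff M (sub_ne_zero.2 hne)).1 ?_)
    have : (f x - r) • (1 : A) = ((x : A) - r • 1) - (x - f x • 1) := by module
    rw [this]
    exact M.sub_mem hr (hf x)
  refine ⟨f, ⟨?_, ?_, ?_, ?_, ?_⟩, fun x hx => huniq x 0 (by simpa using hIM hx)⟩
  · exact huniq 1 1 (by simp)
  · intro x y
    refine huniq _ _ ?_
    have : ((x + y : idealGenOne hmul) : A) - (f x + f y) • 1 =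
        (x - f x • 1) + (y - f y • 1) := by
      rw [Subalgebra.coe_add]; module
    rw [this]
    exact M.add_mem (hf x) (hf y)
  · intro x y
    refine huniq _ _ ?_
    have : ((x * y : idealGenOne hmul) : A) - (f x * f y) • 1 =
        (x - f x • 1) * y + f x • (y - f y • 1) := by
      rw [Subalgebra.coe_mul, sub_mul, smul_one_mul]; module
    rw [this]
    exact M.add_mem (hM.mul_mem_right hmul y.2 (hf x)) (M.smul_mem _ (hf y))
  · intro r x
    refine huniq _ _ ?_
    have : ((r • x : idealGenOne hmul) : A) - (r * f x) • 1 = r • ((x : A) - f x • 1) := by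
      rw [Subalgebra.coe_smul]; module
    rw [this]
    exact M.smul_mem _ (hf x)
  · intro x y z hz
    refine huniq _ _ ?_
    rw [hz, ← smul_one_sup_smul_one hmul]
    exact hM.solid _ _ ((abs_sup_sub_sup_le _ _ _ _).trans (le_abs_self _))
      (M.add_mem (hM.abs_mem _ (hf x)) (hM.abs_mem _ (hf y)))

/-- If `‖x‖ • 1 - |x|` generated an ideal containing `1`, then `|x|` would lie below a smaller
multiple of `1` than `‖x‖ • 1`. So some character vanishes on it, and it takes the value `‖x‖` at
`|x|`. -/
theorem exists_latticeCharacter_norm_eq (hmul : ∀ x y : A, 0 ≤ x → 0 ≤ y → 0 ≤ x * y)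
    (x : idealGenOne hmul) :
    ∃ f ∈ latticeCharacters (idealGenOne hmul), |f x| = ‖(x : A)‖ := by
  have h1 := one_nonneg_of_mul_nonneg hmul
  have hx := abs_le_norm_smul_one hmul x.2
  have hI := idealGen_isOrderIdeal (1 : A)
  have hz : ‖(x : A)‖ • 1 - |(x : A)| ∈ idealGenOne hmul :=
    sub_mem (Subalgebra.smul_mem _ (one_mem _) _) (hI.abs_mem _ x.2)
  have hz0 : 0 ≤ ‖(x : A)‖ • 1 - |(x : A)| := sub_nonneg.2 hx
  have hnot : (1 : A) ∉ idealGen (‖(x : A)‖ • 1 - |(x : A)|) := by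
    rw [mem_idealGen_iff]
    rintro ⟨r, hr, h⟩
    rw [abs_of_nonneg hz0, abs_of_nonneg h1] at h
    set s := r + 1
    have hs : 0 < s := by positivity
    have h' : (1 : A) ≤ s • (‖(x : A)‖ • 1 - |(x : A)|) :=
      h.trans (smul_le_smul_of_nonneg_right (by simp [s]) hz0)
    rw [← inv_smul_le_iff_of_pos hs] at h'
    have h2 : |(x : A)| ≤ (‖(x : A)‖ - s⁻¹) • 1 := by
      rw [sub_smul]
      exact le_sub_comm.1 h'
    have hsinv : 0 < s⁻¹ := inv_pos.2 hs
    -- A negative coefficient admits no norm bound, but it would make a positive multiple of `1`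
    -- nonpositive, hence zero.
    rcases le_or_gt 0 (‖(x : A)‖ - s⁻¹) with hc | hc
    · have := norm_le_of_abs_le_smul_one hc h2
      linarith
    · have h3 : (s⁻¹ - ‖(x : A)‖) • (1 : A) ≤ 0 := by
        have := neg_le_neg ((abs_nonneg (x : A)).trans h2)
        rwa [← neg_smul, neg_sub, neg_zero] at this
      have h4 : (s⁻¹ - ‖(x : A)‖) • (1 : A) = 0 :=
        le_antisymm h3 (smul_nonneg (by linarith) h1)
      have h5 := congrArg norm h4
      rw [norm_smul, NormOneClass.norm_one, mul_one, norm_zero, norm_eq_zero] at h5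
      linarith
  obtain ⟨f, hf, hfz⟩ := exists_latticeCharacter_vanishing hmul
    (idealGen_isOrderIdeal (‖(x : A)‖ • 1 - |(x : A)|)) (sInf_le ⟨hI, hz⟩) hnot
  refine ⟨f, hf, le_antisymm (abs_latticeCharacters_le hmul hf x) ?_⟩
  let a : idealGenOne hmul := ⟨|(x : A)|, hI.abs_mem _ x.2⟩
  have ha : f a = f x ⊔ f ((-1 : ℝ) • x) := hf.2.2.2.2 _ _ _ (by
    rw [Subalgebra.coe_smul, neg_one_smul]; rfl)
  rw [hf.2.2.2.1, neg_one_mul] at ha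
  have h0 := hfz ⟨_, hz⟩ (self_mem_idealGen _)
  have hsum : (⟨_, hz⟩ : idealGenOne hmul) + a = ‖(x : A)‖ • 1 := Subtype.ext (by simp [a])
  have h2 := congrArg f hsum
  rw [hf.2.1, h0, zero_add, latticeCharacters_smul_one hf] at h2
  rw [← h2, ha]
  rfl

end Characters

/-! ### Representation on the space of characters -/

section Representation

variable {A : Type*} [NormedRing A] [NormedAlgebra ℝ A] [Lattice A]

/-- Evaluation of the elements of `B` at the lattice characters of `B`. -/
noncomputable def evalCharacters (B : Subalgebra ℝ A) : B →ₐ[ℝ] C(latticeCharacters B, ℝ) :=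
  AlgHom.ofLinearMap
    { toFun := fun x => ⟨fun f => f.1 x, (continuous_apply x).comp continuous_subtype_val⟩
      map_add' := fun x y => ContinuousMap.ext fun f => f.2.2.1 x y
      map_smul' := fun r x => ContinuousMap.ext fun f => f.2.2.2.2.1 r x }
    (ContinuousMap.ext fun f => f.2.1)
    (fun x y => ContinuousMap.ext fun f => f.2.2.2.1 x y)

variable [NormOneClass A] [IsOrderedAddMonoid A] [IsOrderedModule ℝ A] [HasSolidNorm A]

instance (hmul : ∀ x y : A, 0 ≤ x → 0 ≤ y → 0 ≤ x * y) :
    CompactSpace (latticeCharacters (idealGenOne hmul)) :=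
  isCompact_iff_compactSpace.1 (isCompact_latticeCharacters hmul)

theorem norm_evalCharacters (hmul : ∀ x y : A, 0 ≤ x → 0 ≤ y → 0 ≤ x * y)
    (x : idealGenOne hmul) : ‖evalCharacters (idealGenOne hmul) x‖ = ‖x‖ := by
  refine le_antisymm ((ContinuousMap.norm_le _ (norm_nonneg _)).2 fun f =>
    abs_latticeCharacters_le hmul f.2 x) ?_
  obtain ⟨f, hf, h⟩ := exists_latticeCharacter_norm_eq hmul x
  exact h.symm.le.trans ((evalCharacters (idealGenOne hmul) x).norm_coe_le_norm ⟨f, hf⟩)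

/-- The range is closed, as the isometric image of a complete space, and dense by Stone–Weierstrass;
distinct characters differ at some element, so points are separated. -/
theorem evalCharacters_bijective [CompleteSpace A]
    (hmul : ∀ x y : A, 0 ≤ x → 0 ≤ y → 0 ≤ x * y) :
    Function.Bijective (evalCharacters (idealGenOne hmul)) := by
  have hiso : Isometry (evalCharacters (idealGenOne hmul)) :=
    AddMonoidHomClass.isometry_of_norm _ (norm_evalCharacters hmul)
  refine ⟨hiso.injective, ?_⟩
  have : CompleteSpace (idealGenOne hmul) := (isClosed_idealGen_one hmul).completeSpace_coe
  have hclosed : IsClosed ((evalCharacters (idealGenOne hmul)).range :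
      Set C(latticeCharacters (idealGenOne hmul), ℝ)) := by
    rw [AlgHom.coe_range]
    exact hiso.isClosedEmbedding.isClosed_range
  have hsep : (evalCharacters (idealGenOne hmul)).range.SeparatesPoints := by
    intro f g hfg
    obtain ⟨x, hx⟩ := Function.ne_iff.1 (fun h => hfg (Subtype.ext h) : f.1 ≠ g.1)
    exact ⟨_, ⟨_, ⟨x, rfl⟩, rfl⟩, hx⟩
  have htop := ContinuousMap.subalgebra_topologicalClosure_eq_top_of_separatesPoints _ hsep
  intro g
  have hg : g ∈ (evalCharacters (idealGenOne hmul)).range.topologicalClosure := by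
    rw [htop]
    exact Algebra.mem_top
  rw [← SetLike.mem_coe, Subalgebra.topologicalClosure_coe, hclosed.closure_eq] at hg
  exact hg

theorem isLatticeIsometry_evalCharacters [CompleteSpace A]
    (hmul : ∀ x y : A, 0 ≤ x → 0 ≤ y → 0 ≤ x * y) :
    IsLatticeIsometry (idealGenOne hmul) (unitNorm (1 : A))
      (AlgEquiv.ofBijective _ (evalCharacters_bijective hmul)) := by
  have hI := idealGen_isOrderIdeal (1 : A)
  refine ⟨fun x y => ⟨hI.sup_mem x.2 y.2, ?_⟩, fun x y => ⟨hI.inf_mem x.2 y.2, ?_⟩, fun x => ?_⟩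
  · exact ContinuousMap.ext fun f => f.2.2.2.2.2 x y _ rfl
  -- Characters are only required to preserve suprema; infima follow from `x ⊓ y + x ⊔ y = x + y`.
  · refine ContinuousMap.ext fun f => ?_
    have h1 := f.2.2.2.2.2 x y ⟨_, hI.sup_mem x.2 y.2⟩ rfl
    have h2 : (⟨_, hI.inf_mem x.2 y.2⟩ : idealGenOne hmul) + ⟨_, hI.sup_mem x.2 y.2⟩ = x + y :=
      Subtype.ext (inf_add_sup _ _)
    have h3 := congrArg f.1 h2
    rw [f.2.2.1, f.2.2.1, h1, ← inf_add_sup (f.1 x)] at h3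
    exact add_right_cancel h3
  · rw [unitNorm_one_eq_norm hmul x.2]
    exact norm_evalCharacters hmul x

end Representation

end BLA

theorem theorem3 {A : Type u} [NormedRing A] [NormOneClass A] [NormedAlgebra ℝ A] [CompleteSpace A]
    [Lattice A] [IsOrderedAddMonoid A] [IsOrderedModule ℝ A] [HasSolidNorm A]
    (hmul : ∀ x y : A, 0 ≤ x → 0 ≤ y → 0 ≤ x * y) :
    ∃ B : Subalgebra ℝ A,
      Subalgebra.toSubmodule B = BLA.idealGen (1 : A) ∧
      (BLA.IsBanachLatticeAlgebra B (BLA.unitNorm (1 : A)) ∧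
        ∃ (K : Type u) (_ : TopologicalSpace K) (_ : CompactSpace K) (_ : T2Space K)
          (T : B ≃ₐ[ℝ] C(K, ℝ)), BLA.IsLatticeIsometry B (BLA.unitNorm (1 : A)) T) ∧
      (BLA.IsPrincipalProjectionBand (BLA.idealGen (1 : A)) ∧
        BLA.idealGen (1 : A) = BLA.bandGen (1 : A)) ∧
      BLA.IsInverseClosed B := by
  refine ⟨BLA.idealGenOne hmul, rfl, ⟨BLA.idealGenOne_isBanachLatticeAlgebra hmul, ?_⟩,
    ⟨⟨BLA.idealGen_one_isProjectionBand hmul, 1, BLA.idealGen_one_eq_bandGen hmul⟩,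
      BLA.idealGen_one_eq_bandGen hmul⟩, BLA.idealGenOne_isInverseClosed hmul⟩
  exact ⟨BLA.latticeCharacters (BLA.idealGenOne hmul), inferInstance, inferInstance,
    inferInstance, _, BLA.isLatticeIsometry_evalCharacters hmul⟩
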